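/- Let $n\ge 2$ and let $\Lambda=\mathrm{diag}(\lambda_1,\dots,\lambda_n)$ be a real diagonal matrix with simple spectrum $\sigma(\Lambda)=\{\lambda_1,\dots,\lambda_n\}$. Let $\mathcal T_\Lambda$ be the set of real symmetric tridiagonal $n\times n$ matrices conjugate to $\Lambda$. For an invertible real matrix $M$ let $\mathbf Q(M)$ be the orthogonal factor in the unique factorization $M=\mathbf Q(M)\mathbf R(M)$ with $\mathbf R(M)$ upper triangular with positive diagonal. A matrix is *LU-positive* if it is a product $LU$ with $L$ lower triangular with unit diagonal and $U$ upper triangular with positive diagonal; then $L=\mathbf L(M)$ is unique. For $\pi\in S_n$ put $\lambda_i^\pi=\lambda_{\pi(i)}$ and $\Lambda^\pi=\mathrm{diag}(\lambda_1^\pi,\dots,\lambda_n^\pi)$, and let $\mathcal U_\Lambda^\pi$ be the set of $T\in\mathcal T_\Lambda$ of the form $T=Q_\pi^*\Lambda^\pi Q_\pi$ with $Q_\pi$ orthogonal and LU-positive (such a $Q_\pi$ is unique). The chart $\psi_\pi:\mathcal U_\Lambda^\pi\to\mathbb R^{n-1}$ sends $T$ to the subdiagonal $(\beta_1,\dots,\beta_{n-1})$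 of the lower bidiagonal matrix $\mathbf L(Q_\pi)^{-1}\Lambda^\pi\,\mathbf L(Q_\pi)$. Its inverse is $\phi_\pi(\beta)=\mathbf Q(L)^*\Lambda^\pi\mathbf Q(L)$, where $L$ is the lower triangular matrix with unit diagonal for which $L^{-1}\Lambda^\pi L$ is the lower bidiagonal matrix with diagonal $\Lambda^\pi$ and subdiagonal $\beta$. Let $$\mathcal D_{\mathbf F}=\bigl((\mathbb R\setminus\sigma(\Lambda))\times\mathcal T_\Lambda\bigr)\cup\bigcup_{\pi\in S_n}\{\lambda_{\pi(n)}\}\times\mathcal U_\Lambda^\pi .$$ Define $\mathbf F:\mathcal D_{\mathbf F}\to\mathcal T_\Lambda$ as follows. If $s\notin\sigma(\Lambda)$, then $\mathbf F(s,T)$ is the $QR$ step with shift $s$, $\mathbf F(s,T)=\mathbf Q(T-sI)^*\,T\,\mathbf Q(T-sI)$. If $s=\lambda_{\pi(n)}$ and $T=\phi_\pi(\beta)\in\mathcal U_\Lambda^\pi$, then $$\mathbf F(s,T)=\phi_\pi\Bigl(\Bigl|\tfrac{\lambda_2^\pi-s}{\lambda_1^\pi-s}\Bigr|\beta_1,\dots,\Bigl|\tfrac{\lambda_n^\pi-s}{\lambda_{n-1}^\pi-s}\Bigr|\beta_{n-1}\Bigr)$$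 (this value does not depend on the choice of such a $\pi$). The $QR$ iteration with Rayleigh quotient shift is $G(T)=\mathbf F(T_{n,n},T)$, with domain $\mathcal D_G=\{T\in\mathcal T_\Lambda: (T_{n,n},T)\in\mathcal D_{\mathbf F}\}$. For $\epsilon>0$ let $\Delta_\epsilon=\{T\in\mathcal T_\Lambda: |T_{n,n-1}|\le\epsilon\}$. **Theorem.** There exist $\epsilon>0$ and $c>0$ (depending on $\Lambda$) such that $\Delta_\epsilon\subset\mathcal D_G$, $G(\Delta_\epsilon)\subset\Delta_\epsilon$, and $|G(T)_{n,n-1}|\le c\,|T_{n,n-1}|^3$ for all $T\in\Delta_\epsilon$. -/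

import Mathlib

namespace RayleighQR

open Matrix

/-- Tridiagonal square matrices. -/
def IsTridiagonal {n : ℕ} (T : Matrix (Fin n) (Fin n) ℝ) : Prop :=
  ∀ i j : Fin n, (i.val + 1 < j.val ∨ j.val + 1 < i.val) → T i j = 0

/-- The isospectral manifold `𝒯_Λ`: real symmetric tridiagonal matrices conjugate to
`Λ = diag(lam)`. -/
def isospectral {n : ℕ} (lam : Fin n → ℝ) : Set (Matrix (Fin n) (Fin n) ℝ) :=
  {T | T.IsSymm ∧ IsTridiagonal T ∧ IsConj T (diagonal lam)}

/-- `M = Q R` with `Q` orthogonal and `R` upper triangular with positive diagonal. -/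
def IsQR {n : ℕ} (M Q R : Matrix (Fin n) (Fin n) ℝ) : Prop :=
  Q ∈ orthogonalGroup (Fin n) ℝ ∧ (∀ i j, j < i → R i j = 0) ∧ (∀ i, 0 < R i i) ∧ M = Q * R

/-- The orthogonal factor `𝐐(M)`; it exists and is unique when `M` is invertible. -/
noncomputable def qrQ {n : ℕ} (M : Matrix (Fin n) (Fin n) ℝ) : Matrix (Fin n) (Fin n) ℝ :=
  Classical.epsilon fun Q => ∃ R, IsQR M Q R

/-- Lower triangular with unit diagonal. -/
def IsLowerUnipotent {n : ℕ} (L : Matrix (Fin n) (Fin n) ℝ) : Prop :=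
  (∀ i j, i < j → L i j = 0) ∧ ∀ i, L i i = 1

/-- `M = L U` with `L` lower unipotent and `U` upper triangular with positive diagonal. -/
def IsPosLU {n : ℕ} (M L U : Matrix (Fin n) (Fin n) ℝ) : Prop :=
  IsLowerUnipotent L ∧ (∀ i j, j < i → U i j = 0) ∧ (∀ i, 0 < U i i) ∧ M = L * U

/-- `LU`-positive matrices. -/
def LUPositive {n : ℕ} (M : Matrix (Fin n) (Fin n) ℝ) : Prop :=
  ∃ L U, IsPosLU M L U

/-- The lower unipotent factor `𝐋(M)` of an `LU`-positive matrix (unique when it exists). -/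
noncomputable def luL {n : ℕ} (M : Matrix (Fin n) (Fin n) ℝ) : Matrix (Fin n) (Fin n) ℝ :=
  Classical.epsilon fun L => ∃ U, IsPosLU M L U

/-- `Λ^π = diag(λ_{π(1)}, …, λ_{π(n)})`. -/
def permDiag {n : ℕ} (lam : Fin n → ℝ) (π : Equiv.Perm (Fin n)) : Matrix (Fin n) (Fin n) ℝ :=
  diagonal fun i => lam (π i)

/-- `T = Qᵀ Λ^π Q` is a `π`-normalized diagonalization. -/
def IsNormalizedDiag {n : ℕ} (lam : Fin n → ℝ) (π : Equiv.Perm (Fin n))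
    (T Q : Matrix (Fin n) (Fin n) ℝ) : Prop :=
  Q ∈ orthogonalGroup (Fin n) ℝ ∧ LUPositive Q ∧ T = Qᵀ * permDiag lam π * Q

/-- The chart domain `𝒰_Λ^π`. -/
def chartDomain {n : ℕ} (lam : Fin n → ℝ) (π : Equiv.Perm (Fin n)) :
    Set (Matrix (Fin n) (Fin n) ℝ) :=
  {T | T ∈ isospectral lam ∧ ∃ Q, IsNormalizedDiag lam π T Q}

/-- The orthogonal matrix `Q_π` of the `π`-normalized diagonalization of `T ∈ 𝒰_Λ^π`
(unique when `lam` is injective). -/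
noncomputable def normalizedQ {n : ℕ} (lam : Fin n → ℝ) (π : Equiv.Perm (Fin n))
    (T : Matrix (Fin n) (Fin n) ℝ) : Matrix (Fin n) (Fin n) ℝ :=
  Classical.epsilon fun Q => IsNormalizedDiag lam π T Q

/-- The chart `ψ_π`: the bidiagonal coordinates `β_i = (L⁻¹ Λ^π L)_{i+1,i}` of `T ∈ 𝒰_Λ^π`, where
`L = 𝐋(Q_π)`. Matrices have order `m + 1`, so there are `m` coordinates. -/
noncomputable def chart {m : ℕ} (lam : Fin (m + 1) → ℝ) (π : Equiv.Perm (Fin (m + 1)))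
    (T : Matrix (Fin (m + 1)) (Fin (m + 1)) ℝ) : Fin m → ℝ :=
  fun i => ((luL (normalizedQ lam π T))⁻¹ * permDiag lam π * luL (normalizedQ lam π T))
    i.succ i.castSucc

/-- The lower bidiagonal matrix `B_π` with diagonal `Λ^π` and subdiagonal `β`. -/
noncomputable def bidiag {m : ℕ} (lam : Fin (m + 1) → ℝ) (π : Equiv.Perm (Fin (m + 1)))
    (β : Fin m → ℝ) : Matrix (Fin (m + 1)) (Fin (m + 1)) ℝ :=
  permDiag lam π + ∑ k : Fin m, Matrix.single k.succ k.castSucc (β k)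

/-- The lower unipotent `L_π` with `B_π = L_π⁻¹ Λ^π L_π`
(it exists and is unique when `lam` is injective). -/
noncomputable def bidiagL {m : ℕ} (lam : Fin (m + 1) → ℝ) (π : Equiv.Perm (Fin (m + 1)))
    (β : Fin m → ℝ) : Matrix (Fin (m + 1)) (Fin (m + 1)) ℝ :=
  Classical.epsilon fun L =>
    IsLowerUnipotent L ∧ bidiag lam π β = L⁻¹ * permDiag lam π * L

/-- The inverse chart `φ_π(β) = 𝐐(L_π)ᵀ Λ^π 𝐐(L_π)`. -/
noncomputable def chartInv {m : ℕ} (lam : Fin (m + 1) → ℝ) (π : Equiv.Perm (Fin (m + 1)))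
    (β : Fin m → ℝ) : Matrix (Fin (m + 1)) (Fin (m + 1)) ℝ :=
  (qrQ (bidiagL lam π β))ᵀ * permDiag lam π * qrQ (bidiagL lam π β)

/-- The `QR` step with shift `s ∉ σ(Λ)`: `T ↦ 𝐐(T - s)ᵀ T 𝐐(T - s)`. -/
noncomputable def qrStep {n : ℕ} (s : ℝ) (T : Matrix (Fin n) (Fin n) ℝ) :
    Matrix (Fin n) (Fin n) ℝ :=
  (qrQ (T - s • (1 : Matrix (Fin n) (Fin n) ℝ)))ᵀ * T *
    qrQ (T - s • (1 : Matrix (Fin n) (Fin n) ℝ))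

/-- The shifted step in bidiagonal coordinates: in the chart `π` the coordinate `β_i` is multiplied
by `|(λ_{π(i+1)} - s) / (λ_{π(i)} - s)|`. -/
noncomputable def chartStep {m : ℕ} (lam : Fin (m + 1) → ℝ) (π : Equiv.Perm (Fin (m + 1)))
    (s : ℝ) (T : Matrix (Fin (m + 1)) (Fin (m + 1)) ℝ) :
    Matrix (Fin (m + 1)) (Fin (m + 1)) ℝ :=
  chartInv lam π fun i =>
    |(lam (π i.succ) - s) / (lam (π i.castSucc) - s)| * chart lam π T i

/-- The domain `𝒟_𝐅` of the shifted step: `s ∉ σ(Λ)`, or `s = λ_{π(n)}` and `T ∈ 𝒰_Λ^π` for some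
permutation `π`. -/
def shiftDomain {m : ℕ} (lam : Fin (m + 1) → ℝ) :
    Set (ℝ × Matrix (Fin (m + 1)) (Fin (m + 1)) ℝ) :=
  {p | p.2 ∈ isospectral lam ∧
    (p.1 ∉ Set.range lam ∨ ∃ π : Equiv.Perm (Fin (m + 1)),
      lam (π (Fin.last m)) = p.1 ∧ p.2 ∈ chartDomain lam π)}

open Classical in
/-- The map `𝐅` on `𝒟_𝐅`: the `QR` step when `s ∉ σ(Λ)`; for `s ∈ σ(Λ)` its continuous extension,
given by the formula in any chart `π` with `λ_{π(n)} = s` and `T ∈ 𝒰_Λ^π` (the value does not depend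
on the choice of such a `π`). Values outside `𝒟_𝐅` are meaningless. -/
noncomputable def shiftStep {m : ℕ} (lam : Fin (m + 1) → ℝ) (s : ℝ)
    (T : Matrix (Fin (m + 1)) (Fin (m + 1)) ℝ) : Matrix (Fin (m + 1)) (Fin (m + 1)) ℝ :=
  if s ∉ Set.range lam then qrStep s T
  else chartStep lam
    (Classical.epsilon fun π : Equiv.Perm (Fin (m + 1)) =>
      lam (π (Fin.last m)) = s ∧ T ∈ chartDomain lam π) s T

/-- The domain `𝒟_G` of the `QR` iteration with Rayleigh quotient shift. -/
def rayleighDomain {m : ℕ} (lam : Fin (m + 1) → ℝ) :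
    Set (Matrix (Fin (m + 1)) (Fin (m + 1)) ℝ) :=
  {T | T ∈ isospectral lam ∧ (T (Fin.last m) (Fin.last m), T) ∈ shiftDomain lam}

/-- The `QR` iteration with Rayleigh quotient shift, `G(T) = 𝐅(T_{n,n}, T)`. -/
noncomputable def rayleighStep {m : ℕ} (lam : Fin (m + 1) → ℝ)
    (T : Matrix (Fin (m + 1)) (Fin (m + 1)) ℝ) : Matrix (Fin (m + 1)) (Fin (m + 1)) ℝ :=
  shiftStep lam (T (Fin.last m) (Fin.last m)) T

/-- The entry `T_{n,n-1}` of a matrix of order `n = m + 2`. -/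
def lastSub {m : ℕ} (T : Matrix (Fin (m + 2)) (Fin (m + 2)) ℝ) : ℝ :=
  T (Fin.last (m + 1)) (Fin.last m).castSucc

/-- The deflation neighborhood `Δ_ε`. -/
def deflation {m : ℕ} (lam : Fin (m + 2) → ℝ) (ε : ℝ) :
    Set (Matrix (Fin (m + 2)) (Fin (m + 2)) ℝ) :=
  {T | T ∈ isospectral lam ∧ |lastSub T| ≤ ε}

end RayleighQR

namespace RayleighQR

open Matrix

theorem mul_self_sign {x : ℝ} (hx : x ≠ 0) : (SignType.sign x : ℝ) * (SignType.sign x : ℝ) = 1 := by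
  rcases lt_or_gt_of_ne hx with h | h <;> simp [h]

theorem diagonal_sign_mul_self {n : ℕ} {d : Fin n → ℝ} (hd : ∀ i, d i ≠ 0) :
    diagonal (fun i => (SignType.sign (d i) : ℝ)) * diagonal (fun i => (SignType.sign (d i) : ℝ))
      = 1 := by
  rw [diagonal_mul_diagonal, ← diagonal_one]
  congr 1
  funext i
  exact mul_self_sign (hd i)

/-- Every invertible matrix has a `QR` factorization with positive diagonal. -/
theorem exists_isQR {n : ℕ} {M : Matrix (Fin n) (Fin n) ℝ} (hM : M.det ≠ 0) :
    ∃ Q R, IsQR M Q R := by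
  let f : Fin n → EuclideanSpace ℝ (Fin n) := fun j => WithLp.toLp 2 (fun i => M i j)
  have hcard : Module.finrank ℝ (EuclideanSpace ℝ (Fin n)) = Fintype.card (Fin n) := by simp
  let b := InnerProductSpace.gramSchmidtOrthonormalBasis hcard f
  let P : Matrix (Fin n) (Fin n) ℝ := fun i j => b j i
  have hP : Pᵀ * P = 1 := by
    ext i j
    have := (orthonormal_iff_ite.1 b.orthonormal) i j
    simp only [PiLp.inner_apply, RCLike.inner_apply, conj_trivial] at this
    rw [mul_apply, one_apply, ← this]
    exact Finset.sum_congr rfl fun k _ => mul_comm _ _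
  have hS : ∀ i j, j < i → (Pᵀ * M) i j = 0 := by
    intro i j hij
    have := InnerProductSpace.gramSchmidtOrthonormalBasis_inv_triangular hcard f hij
    simp only [PiLp.inner_apply, RCLike.inner_apply, conj_trivial] at this
    rw [mul_apply, ← this]
    exact Finset.sum_congr rfl fun k _ => mul_comm _ _
  have hP' : P * Pᵀ = 1 := mul_eq_one_comm.1 hP
  have hdet : (Pᵀ * M).det ≠ 0 := by
    rw [det_mul]
    refine mul_ne_zero (fun h => ?_) hM
    have := congrArg det hP
    simp [h] at this
  have hd : ∀ i, (Pᵀ * M) i i ≠ 0 := by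
    rw [det_of_isUpperTriangular (fun i j h => hS i j h)] at hdet
    exact fun i => Finset.prod_ne_zero_iff.1 hdet i (Finset.mem_univ i)
  have hD := diagonal_sign_mul_self hd
  set D := diagonal (fun i => (SignType.sign ((Pᵀ * M) i i) : ℝ)) with hDdef
  refine ⟨P * D, D * (Pᵀ * M), ?_, ?_, ?_, ?_⟩
  · rw [mem_orthogonalGroup_iff, transpose_mul, hDdef, diagonal_transpose, ← hDdef,
      show P * D * (D * Pᵀ) = P * (D * D) * Pᵀ by simp only [Matrix.mul_assoc], hD, Matrix.mul_one,
      hP']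
  · intro i j hij
    rw [hDdef, diagonal_mul, hS i j hij, mul_zero]
  · intro i
    rw [hDdef, diagonal_mul, sign_mul_self]
    exact abs_pos.2 (hd i)
  · rw [show P * D * (D * (Pᵀ * M)) = P * (D * D) * Pᵀ * M by simp only [Matrix.mul_assoc], hD,
      Matrix.mul_one, hP', Matrix.one_mul]

theorem qrQ_spec {n : ℕ} {M : Matrix (Fin n) (Fin n) ℝ} (hM : M.det ≠ 0) :
    ∃ R, IsQR M (qrQ M) R :=
  Classical.epsilon_spec (p := fun Q => ∃ R, IsQR M Q R) (exists_isQR hM)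

theorem transpose_mul_self_of_orthogonal {n : ℕ} {Q : Matrix (Fin n) (Fin n) ℝ}
    (hQ : Q ∈ orthogonalGroup (Fin n) ℝ) : Qᵀ * Q = 1 :=
  (mem_orthogonalGroup_iff' _ _).1 hQ

theorem mul_transpose_self_of_orthogonal {n : ℕ} {Q : Matrix (Fin n) (Fin n) ℝ}
    (hQ : Q ∈ orthogonalGroup (Fin n) ℝ) : Q * Qᵀ = 1 :=
  (mem_orthogonalGroup_iff _ _).1 hQ

/-- A symmetric matrix that is intertwined with an upper Hessenberg matrix by an upper triangular
one with positive diagonal is tridiagonal. -/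
theorem isTridiagonal_of_mul_eq_mul {n : ℕ} {S R H : Matrix (Fin n) (Fin n) ℝ} (hS : S.IsSymm)
    (hR : ∀ i j, j < i → R i j = 0) (hR0 : ∀ i, 0 < R i i)
    (hH : ∀ i j : Fin n, j.val + 1 < i.val → H i j = 0) (h : S * R = R * H) :
    IsTridiagonal S := by
  have hlow : ∀ j : ℕ, ∀ i k : Fin n, k.val = j → j + 1 < i.val → S i k = 0 := by
    intro j
    induction j using Nat.strong_induction_on with
    | _ j ih =>
      intro i k hk hi
      have h0 : (R * H) i k = 0 := by
        rw [mul_apply]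
        refine Finset.sum_eq_zero fun a _ => ?_
        rcases lt_or_ge a i with ha | ha
        · rw [hR i a ha, zero_mul]
        · rw [hH a k (by have : i.val ≤ a.val := ha; omega), mul_zero]
      rw [← h, mul_apply, Finset.sum_eq_single k] at h0
      · exact (mul_eq_zero.1 h0).resolve_right (hR0 k).ne'
      · intro a _ hak
        rcases lt_or_gt_of_ne hak with ha | ha
        · rw [ih a.val (by have : a.val < k.val := ha; omega) i a rfl
            (by have : a.val < k.val := ha; omega), zero_mul]
        · rw [hR a k ha, mul_zero]
      · simp
  rintro i j (hij | hij)
  · rw [← hS.apply]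
    exact hlow _ j i rfl hij
  · exact hlow _ i j rfl hij

theorem isConj_diagonal_of_orthogonal {n : ℕ} {lam : Fin n → ℝ} {T Q : Matrix (Fin n) (Fin n) ℝ}
    (hQ : Q ∈ orthogonalGroup (Fin n) ℝ) (hT : IsConj T (diagonal lam)) :
    IsConj (Qᵀ * T * Q) (diagonal lam) := by
  refine IsConj.trans ?_ hT
  have h1 := transpose_mul_self_of_orthogonal hQ
  have h2 := mul_transpose_self_of_orthogonal hQ
  refine ⟨⟨Q, Qᵀ, h2, h1⟩, ?_⟩
  simp only [SemiconjBy]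
  rw [← Matrix.mul_assoc, ← Matrix.mul_assoc, h2, Matrix.one_mul]

theorem isConj_permDiag {n : ℕ} (lam : Fin n → ℝ) (π : Equiv.Perm (Fin n)) :
    IsConj (permDiag lam π) (diagonal lam) := by
  have h (σ : Equiv.Perm (Fin n)) : Equiv.Perm.permMatrix ℝ σ * Equiv.Perm.permMatrix ℝ σ⁻¹ = 1 := by
    rw [← permMatrix_mul]; simp
  refine ⟨⟨Equiv.Perm.permMatrix ℝ π⁻¹, Equiv.Perm.permMatrix ℝ π, by simpa using h π⁻¹, h π⟩, ?_⟩
  simp only [SemiconjBy]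
  ext i j
  rw [permDiag, mul_diagonal, diagonal_mul]
  simp only [Equiv.Perm.permMatrix, PEquiv.toMatrix_apply, Equiv.toPEquiv_apply]
  by_cases hij : j = π⁻¹ i
  · subst hij; simp
  · have : ¬ (π.symm i = j) := fun h => hij h.symm
    simp [this]

theorem isSymm_transpose_mul_mul {n : ℕ} {T Q : Matrix (Fin n) (Fin n) ℝ} (hT : T.IsSymm) :
    (Qᵀ * T * Q).IsSymm := by
  rw [IsSymm, transpose_mul, transpose_mul, transpose_transpose, hT.eq, Matrix.mul_assoc]

/-- Symmetric matrices with simple spectrum are orthogonally diagonalizable, with the eigenvalues in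
the given order. -/
theorem exists_orthogonal_diagonalization {n : ℕ} {lam : Fin n → ℝ} (hlam : Function.Injective lam)
    {T : Matrix (Fin n) (Fin n) ℝ} (hT : T.IsSymm) (hc : IsConj T (diagonal lam)) :
    ∃ V ∈ orthogonalGroup (Fin n) ℝ, V * T = diagonal lam * V := by
  obtain ⟨u, hu⟩ := hc
  set W : Matrix (Fin n) (Fin n) ℝ := u.val with hW
  have hu' : W * T = diagonal lam * W := hu
  have hN : ∀ i j, i ≠ j → (W * Wᵀ) i j = 0 := by
    intro i j hij
    have e : diagonal lam * (W * Wᵀ) = (W * Wᵀ) * diagonal lam := by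
      have := congrArg transpose hu'
      rw [transpose_mul, transpose_mul, hT.eq, diagonal_transpose] at this
      rw [← Matrix.mul_assoc, ← hu', Matrix.mul_assoc, this, Matrix.mul_assoc]
    have e' := congrFun (congrFun e i) j
    rw [diagonal_mul, mul_diagonal] at e'
    have : (lam i - lam j) * (W * Wᵀ) i j = 0 := by linarith
    exact (mul_eq_zero.1 this).resolve_left (sub_ne_zero.2 fun h => hij (hlam h))
  have hpos : ∀ i, 0 < (W * Wᵀ) i i := by
    intro i
    have hnn : 0 ≤ (W * Wᵀ) i i := by
      rw [mul_apply]
      exact Finset.sum_nonneg fun k _ => mul_self_nonneg _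
    refine lt_of_le_of_ne hnn fun h0 => ?_
    have hz : ∀ j, (W * Wᵀ) i j = 0 := fun j => by
      by_cases hij : i = j
      · rw [← hij, ← h0]
      · exact hN i j hij
    have hdet : (W * Wᵀ).det ≠ 0 := by
      have : W.det ≠ 0 := by
        have := (Matrix.isUnit_iff_isUnit_det W).1 u.isUnit
        exact this.ne_zero
      rw [det_mul, det_transpose]
      exact mul_ne_zero this this
    exact hdet (det_eq_zero_of_row_eq_zero i hz)
  set E := diagonal (fun i => (√((W * Wᵀ) i i))⁻¹) with hE
  refine ⟨E * W, ?_, ?_⟩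
  · rw [mem_orthogonalGroup_iff, transpose_mul, hE, diagonal_transpose, ← hE,
      show E * W * (Wᵀ * E) = E * (W * Wᵀ) * E by simp only [Matrix.mul_assoc]]
    ext i j
    rw [hE, mul_diagonal, diagonal_mul]
    by_cases hij : i = j
    · subst hij
      rw [one_apply_eq]
      have h1 := Real.mul_self_sqrt (hpos i).le
      have h2 := (Real.sqrt_pos.2 (hpos i)).ne'
      field_simp
      linarith
    · rw [hN i j hij, one_apply_ne hij]; simp
  · rw [Matrix.mul_assoc, hu', ← Matrix.mul_assoc, ← Matrix.mul_assoc, hE, diagonal_mul_diagonal,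
      diagonal_mul_diagonal]
    simp only [mul_comm]

/-- A matrix with a nonzero minor at `(k, last)` has an `LU` factorization after a
permutation of its rows that puts row `k` last. -/
theorem exists_perm_lu {n : ℕ} (A : Matrix (Fin (n + 1)) (Fin (n + 1)) ℝ)
    (k : Fin (n + 1)) (hk : (A.submatrix k.succAbove Fin.castSucc).det ≠ 0) :
    ∃ σ : Equiv.Perm (Fin (n + 1)), σ (Fin.last n) = k ∧
      ∃ L U : Matrix (Fin (n + 1)) (Fin (n + 1)) ℝ, IsLowerUnipotent L ∧
        (∀ i j, j < i → U i j = 0) ∧ A.submatrix σ id = L * U := by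
  induction n with
  | zero =>
    have hs : ∀ i j : Fin (0 + 1), i = j := by omega
    refine ⟨1, hs _ _, 1, A, ⟨fun i j h => absurd (hs i j) h.ne, fun i => one_apply_eq i⟩,
      fun i j h => absurd (hs i j) h.ne', ?_⟩
    rw [Matrix.one_mul]; rfl
  | succ n ih =>
    set B := A.submatrix k.succAbove Fin.castSucc with hB
    obtain ⟨l, hl⟩ : ∃ l : Fin (n + 1), (B.submatrix l.succAbove Fin.castSucc).det ≠ 0 := by
      by_contra! h
      refine hk ?_
      rw [det_succ_column B (Fin.last n)]
      refine Finset.sum_eq_zero fun i _ => ?_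
      rw [show (Fin.last n).succAbove = Fin.castSucc from funext Fin.succAbove_last_apply, h i,
          mul_zero]
    obtain ⟨σ, -, L, U, hL, hU, hLU⟩ := ih B l hl
    have hdet : L.det * U.det ≠ 0 := by
      rw [← det_mul, ← hLU, det_permute]
      refine mul_ne_zero ?_ hk
      rcases Int.units_eq_one_or (Equiv.Perm.sign σ) with h | h <;> simp [h]
    have hLd : IsUnit L.det := isUnit_iff_ne_zero.2 (left_ne_zero_of_mul hdet)
    have hUd : IsUnit U.det := isUnit_iff_ne_zero.2 (right_ne_zero_of_mul hdet)
    set x : Fin (n + 1) → ℝ := fun i => A (k.succAbove (σ i)) (Fin.last _) with hx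
    set y : Fin (n + 1) → ℝ := fun j => A k j.castSucc with hy
    have hx' : L *ᵥ (L⁻¹ *ᵥ x) = x := by rw [mulVec_mulVec, mul_nonsing_inv _ hLd, one_mulVec]
    have hy' : (y ᵥ* U⁻¹) ᵥ* U = y := by rw [vecMul_vecMul, nonsing_inv_mul _ hUd, vecMul_one]
    set x' := L⁻¹ *ᵥ x
    set y' := y ᵥ* U⁻¹
    let τ : Equiv.Perm (Fin (n + 1 + 1)) :=
      finSuccEquivLast.trans ((Equiv.optionCongr σ).trans (finSuccEquiv' k).symm)
    have hτl : τ (Fin.last _) = k := by simp [τ]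
    have hτc : ∀ i, τ (Fin.castSucc i) = k.succAbove (σ i) := fun i => by simp [τ]
    let L' : Matrix (Fin (n + 1 + 1)) (Fin (n + 1 + 1)) ℝ := fun i =>
      Fin.lastCases (motive := fun _ => Fin (n + 1 + 1) → ℝ) (Fin.snoc (α := fun _ => ℝ) y' 1)
        (fun i => Fin.snoc (α := fun _ => ℝ) (L i) 0) i
    let U' : Matrix (Fin (n + 1 + 1)) (Fin (n + 1 + 1)) ℝ := fun i =>
      Fin.lastCases (motive := fun _ => Fin (n + 1 + 1) → ℝ)
        (Fin.snoc (α := fun _ => ℝ) 0 (A k (Fin.last _) - y' ⬝ᵥ x'))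
        (fun i => Fin.snoc (α := fun _ => ℝ) (U i) (x' i)) i
    have L1 : ∀ i j, L' (Fin.castSucc i) (Fin.castSucc j) = L i j := fun i j => by simp [L']
    have L2 : ∀ i, L' (Fin.castSucc i) (Fin.last _) = 0 := fun i => by simp [L']
    have L3 : ∀ j, L' (Fin.last _) (Fin.castSucc j) = y' j := fun j => by simp [L']
    have L4 : L' (Fin.last _) (Fin.last _) = 1 := by simp [L']
    have U1 : ∀ i j, U' (Fin.castSucc i) (Fin.castSucc j) = U i j := fun i j => by simp [U']
    have U2 : ∀ i, U' (Fin.castSucc i) (Fin.last _) = x' i := fun i => by simp [U']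
    have U3 : ∀ j, U' (Fin.last _) (Fin.castSucc j) = 0 := fun j => by simp [U']
    have U4 : U' (Fin.last _) (Fin.last _) = A k (Fin.last _) - y' ⬝ᵥ x' := by simp [U']
    refine ⟨τ, hτl, L', U', ⟨fun i j => ?_, fun i => ?_⟩, fun i j => ?_, ?_⟩
    · refine Fin.lastCases (fun h => ?_) (fun i => ?_) i
      · exact absurd (Fin.le_last j) h.not_ge
      · refine Fin.lastCases (fun _ => L2 i) (fun j h => ?_) j
        rw [L1]
        exact hL.1 i j (Fin.castSucc_lt_castSucc_iff.1 h)
    · refine Fin.lastCases L4 (fun i => ?_) i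
      rw [L1]
      exact hL.2 i
    · refine Fin.lastCases (fun h => ?_) (fun j => ?_) j
      · exact absurd (Fin.le_last i) h.not_ge
      · refine Fin.lastCases (fun _ => U3 j) (fun i h => ?_) i
        rw [U1]
        exact hU i j (Fin.castSucc_lt_castSucc_iff.1 h)
    · ext i j
      rw [mul_apply, Fin.sum_univ_castSucc, submatrix_apply, id]
      refine Fin.lastCases ?_ (fun i => ?_) i <;> refine Fin.lastCases ?_ (fun j => ?_) j
      · simp only [hτl, L3, L4, U2, U4, dotProduct]
        ring
      · simp only [hτl, L3, L4, U1, U3, mul_zero, add_zero]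
        exact (congrFun hy' j).symm
      · simp only [hτc, L1, L2, U2, zero_mul, add_zero]
        exact (congrFun hx' i).symm
      · simp only [hτc, L1, L2, U1, zero_mul, add_zero]
        have := congrFun (congrFun hLU i) j
        rwa [mul_apply] at this

/-- If the eigenvector of `lam k` has nonzero last entry, then the matrix lies in some chart domain
whose last eigenvalue is `lam k`. -/
theorem exists_mem_chartDomain {m : ℕ} {lam : Fin (m + 1) → ℝ}
    {T V : Matrix (Fin (m + 1)) (Fin (m + 1)) ℝ} (hT : T ∈ isospectral lam)
    (hV : V ∈ orthogonalGroup (Fin (m + 1)) ℝ) (hVT : V * T = diagonal lam * V)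
    {k : Fin (m + 1)} (hk : V k (Fin.last m) ≠ 0) :
    ∃ π : Equiv.Perm (Fin (m + 1)), π (Fin.last m) = k ∧ T ∈ chartDomain lam π := by
  have hVV := transpose_mul_self_of_orthogonal hV
  have hVV' := mul_transpose_self_of_orthogonal hV
  have hdetV : V.det ≠ 0 := fun h => by
    have := congrArg det hVV
    simp [h] at this
  have hminor : (V.submatrix k.succAbove Fin.castSucc).det ≠ 0 := by
    intro h0
    have h1 : V.adjugate (Fin.last m) k = 0 := by
      rw [adjugate_fin_succ_eq_det_submatrix,
        show (Fin.last m).succAbove = Fin.castSucc from funext Fin.succAbove_last_apply, h0,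
        mul_zero]
    have h2 : V.adjugate = V.det • Vᵀ := by
      rw [← Matrix.mul_one V.adjugate, ← hVV', ← Matrix.mul_assoc, adjugate_mul, smul_mul,
        Matrix.one_mul]
    rw [h2, Matrix.smul_apply, transpose_apply, smul_eq_mul] at h1
    exact mul_ne_zero hdetV hk h1
  obtain ⟨σ, hσ, L, U, hL, hU, hLU⟩ := exists_perm_lu V k hminor
  have hdet : L.det * U.det ≠ 0 := by
    rw [← det_mul, ← hLU, det_permute]
    refine mul_ne_zero ?_ hdetV
    rcases Int.units_eq_one_or (Equiv.Perm.sign σ) with h | h <;> simp [h]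
  have hd : ∀ i, U i i ≠ 0 := by
    have := right_ne_zero_of_mul hdet
    rw [det_of_isUpperTriangular (fun i j h => hU i j h)] at this
    exact fun i => Finset.prod_ne_zero_iff.1 this i (Finset.mem_univ i)
  have hDD := diagonal_sign_mul_self hd
  set D := diagonal (fun i => (SignType.sign (U i i) : ℝ)) with hD
  have hDt : Dᵀ = D := diagonal_transpose _
  have hWW : (V.submatrix σ id)ᵀ * V.submatrix σ id = 1 := by
    rw [transpose_submatrix, submatrix_mul_equiv, hVV, submatrix_id_id]
  refine ⟨σ, hσ, hT, D * V.submatrix σ id, ?_, ⟨D * L * D, D * U, ⟨?_, ?_⟩, ?_, ?_, ?_⟩, ?_⟩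
  · rw [mem_orthogonalGroup_iff', transpose_mul, hDt, Matrix.mul_assoc, ← Matrix.mul_assoc D, hDD,
      Matrix.one_mul, hWW]
  · intro i j h
    rw [hD, mul_diagonal, diagonal_mul, hL.1 i j h, mul_zero, zero_mul]
  · intro i
    rw [hD, mul_diagonal, diagonal_mul, hL.2 i, mul_one, mul_self_sign (hd i)]
  · intro i j h
    rw [hD, diagonal_mul, hU i j h, mul_zero]
  · intro i
    rw [hD, diagonal_mul, sign_mul_self]
    exact abs_pos.2 (hd i)
  · rw [hLU, Matrix.mul_assoc (D * L), ← Matrix.mul_assoc D D, hDD, Matrix.one_mul,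
      Matrix.mul_assoc]
  · have hcomm : D * permDiag lam σ * D = permDiag lam σ := by
      rw [hD, permDiag, diagonal_mul_diagonal, diagonal_mul_diagonal]
      congr 1
      funext i
      rw [mul_right_comm, mul_self_sign (hd i), one_mul]
    have hperm : permDiag lam σ * V.submatrix σ id = (V * T).submatrix σ id := by
      rw [hVT]
      ext i j
      rw [permDiag, diagonal_mul, submatrix_apply, submatrix_apply, diagonal_mul]
    calc T = Vᵀ * (V * T) := by rw [← Matrix.mul_assoc, hVV, Matrix.one_mul]
      _ = (V.submatrix σ id)ᵀ * (V * T).submatrix σ id := by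
        rw [transpose_submatrix, submatrix_mul_equiv, submatrix_id_id]
      _ = (V.submatrix σ id)ᵀ * (D * permDiag lam σ * D * V.submatrix σ id) := by
        rw [hcomm, hperm]
      _ = _ := by rw [transpose_mul, hDt]; simp only [Matrix.mul_assoc]

/-- The explicit matrix of eigenvectors of a lower bidiagonal matrix. -/
noncomputable def bidiagEigen {m : ℕ} (μ : Fin (m + 1) → ℝ) (β : Fin m → ℝ) :
    Matrix (Fin (m + 1)) (Fin (m + 1)) ℝ := fun i j =>
  if j ≤ i then ∏ k : Fin m with j ≤ k.castSucc ∧ k.castSucc < i, β k / (μ i - μ k.castSucc) else 0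

theorem isLowerUnipotent_bidiagEigen {m : ℕ} (μ : Fin (m + 1) → ℝ) (β : Fin m → ℝ) :
    IsLowerUnipotent (bidiagEigen μ β) := by
  refine ⟨fun i j h => if_neg h.not_ge, fun i => ?_⟩
  rw [bidiagEigen, if_pos le_rfl]
  refine Finset.prod_eq_one fun k hk => ?_
  have := (Finset.mem_filter.1 hk).2
  exact absurd this.1 this.2.not_ge

theorem bidiagEigen_castSucc {m : ℕ} {μ : Fin (m + 1) → ℝ} (hμ : Function.Injective μ)
    (β : Fin m → ℝ) (i : Fin (m + 1)) (k : Fin m) :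
    (μ i - μ k.castSucc) * bidiagEigen μ β i k.castSucc = bidiagEigen μ β i k.succ * β k := by
  rcases lt_trichotomy i k.castSucc with h | h | h
  · rw [bidiagEigen, bidiagEigen, if_neg h.not_ge,
      if_neg (h.trans k.castSucc_lt_succ).not_ge, mul_zero, zero_mul]
  · subst h
    rw [sub_self, zero_mul, (isLowerUnipotent_bidiagEigen μ β).1 _ _ k.castSucc_lt_succ, zero_mul]
  · have hs : k.succ ≤ i := Fin.castSucc_lt_iff_succ_le.1 h
    rw [bidiagEigen, bidiagEigen, if_pos h.le, if_pos hs]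
    have hset : (Finset.univ.filter fun l : Fin m => k.castSucc ≤ l.castSucc ∧ l.castSucc < i) =
        insert k (Finset.univ.filter fun l : Fin m => k.succ ≤ l.castSucc ∧ l.castSucc < i) := by
      ext l
      simp only [Finset.mem_filter, Finset.mem_univ, true_and, Finset.mem_insert, Fin.ext_iff,
        Fin.le_def, Fin.lt_def, Fin.val_castSucc, Fin.val_succ] at h ⊢
      omega
    rw [hset, Finset.prod_insert]
    · have : μ i - μ k.castSucc ≠ 0 := sub_ne_zero.2 fun e => h.ne' (hμ e)
      field_simp
    · simp [Fin.le_def]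

theorem mul_bidiag_castSucc {m : ℕ} (lam : Fin (m + 1) → ℝ) (π : Equiv.Perm (Fin (m + 1)))
    (β : Fin m → ℝ) (L : Matrix (Fin (m + 1)) (Fin (m + 1)) ℝ) (i : Fin (m + 1)) (k : Fin m) :
    (L * bidiag lam π β) i k.castSucc =
      L i k.castSucc * lam (π k.castSucc) + L i k.succ * β k := by
  rw [bidiag, Matrix.mul_add, Matrix.add_apply, permDiag, mul_diagonal, Matrix.mul_sum, Matrix.sum_apply,
    Finset.sum_eq_single k]
  · rw [mul_single_apply_same]
  · intro l _ hl
    exact mul_single_apply_of_ne _ _ _ _ _ (fun h => hl (Fin.castSucc_injective _ h).symm) _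
  · simp

theorem mul_bidiag_last {m : ℕ} (lam : Fin (m + 1) → ℝ) (π : Equiv.Perm (Fin (m + 1)))
    (β : Fin m → ℝ) (L : Matrix (Fin (m + 1)) (Fin (m + 1)) ℝ) (i : Fin (m + 1)) :
    (L * bidiag lam π β) i (Fin.last m) = L i (Fin.last m) * lam (π (Fin.last m)) := by
  rw [bidiag, Matrix.mul_add, Matrix.add_apply, permDiag, mul_diagonal, Matrix.mul_sum, Matrix.sum_apply,
    Finset.sum_eq_zero, add_zero]
  intro l _
  exact mul_single_apply_of_ne _ _ _ _ _ (Fin.castSucc_lt_last l).ne' _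

theorem det_of_isLowerUnipotent {n : ℕ} {L : Matrix (Fin n) (Fin n) ℝ} (hL : IsLowerUnipotent L) :
    L.det = 1 := by
  rw [det_of_isLowerTriangular L fun i j h => hL.1 i j h]
  exact Finset.prod_eq_one fun i _ => hL.2 i

theorem bidiagL_spec {m : ℕ} {lam : Fin (m + 1) → ℝ} (hlam : Function.Injective lam)
    (π : Equiv.Perm (Fin (m + 1))) (β : Fin m → ℝ) :
    IsLowerUnipotent (bidiagL lam π β) ∧
      permDiag lam π * bidiagL lam π β = bidiagL lam π β * bidiag lam π β := by
  have hμ : Function.Injective fun i => lam (π i) := hlam.comp π.injective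
  have key : ∃ L, IsLowerUnipotent L ∧ bidiag lam π β = L⁻¹ * permDiag lam π * L := by
    set L := bidiagEigen (fun i => lam (π i)) β with hLdef
    have hL : IsLowerUnipotent L := isLowerUnipotent_bidiagEigen _ _
    refine ⟨L, hL, ?_⟩
    have hu : IsUnit L.det := by rw [det_of_isLowerUnipotent hL]; exact isUnit_one
    have e : permDiag lam π * L = L * bidiag lam π β := by
      ext i j
      refine Fin.lastCases ?_ (fun k => ?_) j
      · rw [mul_bidiag_last, permDiag, diagonal_mul]
        rcases eq_or_ne i (Fin.last m) with h | h
        · rw [h, mul_comm]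
        · rw [hL.1 i _ (Fin.lt_last_iff_ne_last.2 h), mul_zero, zero_mul]
      · rw [mul_bidiag_castSucc, permDiag, diagonal_mul]
        have := bidiagEigen_castSucc hμ β i k
        rw [← hLdef] at this
        linarith
    rw [Matrix.mul_assoc, e, nonsing_inv_mul_cancel_left _ _ hu]
  have h : IsLowerUnipotent (bidiagL lam π β) ∧
      bidiag lam π β = (bidiagL lam π β)⁻¹ * permDiag lam π * bidiagL lam π β :=
    Classical.epsilon_spec key
  refine ⟨h.1, ?_⟩
  have hu : IsUnit (bidiagL lam π β).det := by rw [det_of_isLowerUnipotent h.1]; exact isUnit_one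
  conv_rhs => rw [h.2, Matrix.mul_assoc, mul_nonsing_inv_cancel_left _ _ hu]

theorem bidiag_apply_eq_zero {m : ℕ} (lam : Fin (m + 1) → ℝ) (π : Equiv.Perm (Fin (m + 1)))
    (β : Fin m → ℝ) {i j : Fin (m + 1)} (h : j.val + 1 < i.val) : bidiag lam π β i j = 0 := by
  have hj : j = Fin.castSucc ⟨j.val, by omega⟩ := rfl
  rw [← Matrix.one_mul (bidiag lam π β), hj, mul_bidiag_castSucc, one_apply_ne, one_apply_ne] <;>
    simp [Fin.ext_iff] <;> omega

/-- The inverse chart intertwines with the bidiagonal matrix by an upper triangular one. -/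
theorem chartInv_mul_eq {m : ℕ} {lam : Fin (m + 1) → ℝ} (hlam : Function.Injective lam)
    (π : Equiv.Perm (Fin (m + 1))) (β : Fin m → ℝ) :
    ∃ R : Matrix (Fin (m + 1)) (Fin (m + 1)) ℝ, (∀ i j, j < i → R i j = 0) ∧ (∀ i, 0 < R i i) ∧
      chartInv lam π β * R = R * bidiag lam π β := by
  obtain ⟨hL, hLB⟩ := bidiagL_spec hlam π β
  obtain ⟨R, hQ, hR, hR0, hQR⟩ := qrQ_spec (M := bidiagL lam π β)
    (by rw [det_of_isLowerUnipotent hL]; exact one_ne_zero)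
  have hR' : (qrQ (bidiagL lam π β))ᵀ * bidiagL lam π β = R := by
    conv_lhs => rhs; rw [hQR]
    rw [← Matrix.mul_assoc, transpose_mul_self_of_orthogonal hQ, Matrix.one_mul]
  refine ⟨R, hR, hR0, ?_⟩
  rw [chartInv, Matrix.mul_assoc, ← hQR, Matrix.mul_assoc, hLB, ← Matrix.mul_assoc, hR']

theorem chartInv_mem_isospectral {m : ℕ} {lam : Fin (m + 1) → ℝ} (hlam : Function.Injective lam)
    (π : Equiv.Perm (Fin (m + 1))) (β : Fin m → ℝ) : chartInv lam π β ∈ isospectral lam := by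
  have hsymm : (chartInv lam π β).IsSymm := isSymm_transpose_mul_mul (isSymm_diagonal _)
  obtain ⟨R, hR, hR0, h⟩ := chartInv_mul_eq hlam π β
  obtain ⟨R', hQ, -⟩ := qrQ_spec (M := bidiagL lam π β)
    (by rw [det_of_isLowerUnipotent (bidiagL_spec hlam π β).1]; exact one_ne_zero)
  exact ⟨hsymm, isTridiagonal_of_mul_eq_mul hsymm hR hR0
    (fun i j hij => bidiag_apply_eq_zero lam π β hij) h,
    isConj_diagonal_of_orthogonal hQ (isConj_permDiag lam π)⟩

theorem lastSub_chartInv_eq_zero {m : ℕ} {lam : Fin (m + 2) → ℝ} (hlam : Function.Injective lam)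
    (π : Equiv.Perm (Fin (m + 2))) {β : Fin (m + 1) → ℝ} (hβ : β (Fin.last m) = 0) :
    lastSub (chartInv lam π β) = 0 := by
  have htri := (chartInv_mem_isospectral hlam π β).2.1
  obtain ⟨R, hR, hR0, h⟩ := chartInv_mul_eq hlam π β
  have e := congrFun (congrFun h (Fin.last (m + 1))) (Fin.last m).castSucc
  rw [mul_bidiag_castSucc, hβ, mul_zero, add_zero, hR _ _ (Fin.castSucc_lt_last _), zero_mul,
    mul_apply, Fin.sum_univ_castSucc, hR _ _ (Fin.castSucc_lt_last _), mul_zero, add_zero,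
    Finset.sum_eq_single (Fin.last m)] at e
  · exact (mul_eq_zero.1 e).resolve_right (hR0 _).ne'
  · intro a _ ha
    rw [htri _ _ (Or.inr _), zero_mul]
    have : a.val ≠ m := fun h => ha (Fin.ext h)
    have := a.isLt
    simp only [Fin.val_castSucc, Fin.val_last]
    omega
  · simp

section Estimate

variable {n : ℕ} {lam c d : Fin n → ℝ} {γ s b ρ : ℝ}

theorem exists_abs_sub_le (hc : ∑ i, c i ^ 2 = 1) (h2 : ∑ i, c i ^ 2 * (lam i - s) ^ 2 = b ^ 2) :
    ∃ k, |lam k - s| ≤ |b| := by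
  by_contra! h
  have hle : ∀ i, c i ^ 2 * b ^ 2 ≤ c i ^ 2 * (lam i - s) ^ 2 := fun i =>
    mul_le_mul_of_nonneg_left (sq_le_sq.2 (h i).le) (sq_nonneg _)
  have hz : ∀ i, c i = 0 := by
    intro i
    have hs : ∑ i, c i ^ 2 * b ^ 2 = ∑ i, c i ^ 2 * (lam i - s) ^ 2 := by
      rw [h2, ← Finset.sum_mul, hc, one_mul]
    have := (Finset.sum_eq_sum_iff_of_le fun i _ => hle i).1 hs i (Finset.mem_univ i)
    by_contra hci
    have := mul_left_cancel₀ (pow_ne_zero 2 hci) this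
    exact absurd (sq_lt_sq.2 (h i)) this.not_lt
  simp [hz] at hc

theorem le_abs_sub_of_gap (hγ : ∀ i j, i ≠ j → γ ≤ |lam i - lam j|) {k : Fin n}
    (hk : |lam k - s| ≤ γ / 4) {i : Fin n} (hi : i ≠ k) : 3 * γ / 4 ≤ |lam i - s| := by
  have h1 := hγ i k hi
  have h2 : |lam i - lam k| ≤ |lam i - s| + |lam k - s| := by
    rw [show lam i - lam k = (lam i - s) - (lam k - s) by ring]
    exact abs_sub _ _
  linarith

theorem sum_erase_sq_le (hγ0 : 0 < γ) (hγ : ∀ i j, i ≠ j → γ ≤ |lam i - lam j|)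
    (h2 : ∑ i, c i ^ 2 * (lam i - s) ^ 2 = b ^ 2) {k : Fin n} (hk : |lam k - s| ≤ γ / 4) :
    9 * γ ^ 2 / 16 * ∑ i ∈ Finset.univ.erase k, c i ^ 2 ≤ b ^ 2 := by
  rw [← h2, ← Finset.add_sum_erase _ _ (Finset.mem_univ k), Finset.mul_sum]
  refine le_add_of_nonneg_of_le (by positivity) (Finset.sum_le_sum fun i hi => ?_)
  have := le_abs_sub_of_gap hγ hk (Finset.ne_of_mem_erase hi)
  have : (3 * γ / 4) ^ 2 ≤ (lam i - s) ^ 2 := by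
    rw [← sq_abs (lam i - s)]; gcongr
  nlinarith [sq_nonneg (c i)]

/-- The component of the last basis vector along the nearby eigenvector dominates. -/
theorem le_sq_of_gap (hγ0 : 0 < γ) (hγ : ∀ i j, i ≠ j → γ ≤ |lam i - lam j|)
    (hc : ∑ i, c i ^ 2 = 1) (h2 : ∑ i, c i ^ 2 * (lam i - s) ^ 2 = b ^ 2) (hb : |b| ≤ γ / 4)
    {k : Fin n} (hk : |lam k - s| ≤ γ / 4) : 8 / 9 ≤ c k ^ 2 := by
  have h := sum_erase_sq_le hγ0 hγ h2 hk
  have hb2 : b ^ 2 ≤ (γ / 4) ^ 2 := by rw [← sq_abs b]; gcongr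
  rw [← Finset.add_sum_erase _ _ (Finset.mem_univ k)] at hc
  have : γ ^ 2 * (9 * ∑ i ∈ Finset.univ.erase k, c i ^ 2) ≤ γ ^ 2 * 1 := by nlinarith
  have := le_of_mul_le_mul_left this (by positivity)
  linarith

/-- One step of Rayleigh quotient iteration reduces the residual cubically. -/
theorem exists_sum_residual_le (hγ0 : 0 < γ) (hγ : ∀ i j, i ≠ j → γ ≤ |lam i - lam j|)
    (hc : ∑ i, c i ^ 2 = 1) (hd : ∑ i, d i ^ 2 = 1) (h1 : ∑ i, c i ^ 2 * (lam i - s) = 0)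
    (h2 : ∑ i, c i ^ 2 * (lam i - s) ^ 2 = b ^ 2) (hb : |b| ≤ γ / 4)
    (hρ : ∀ i, (lam i - s) * d i = ρ * c i) :
    ∃ k, ∑ i, ((lam i - lam k) * d i) ^ 2 ≤ (16 / γ ^ 2 * |b| ^ 3) ^ 2 := by
  obtain ⟨k, hkb⟩ := exists_abs_sub_le hc h2
  have hk : |lam k - s| ≤ γ / 4 := hkb.trans hb
  have hE := sum_erase_sq_le hγ0 hγ h2 hk
  have hck := le_sq_of_gap hγ0 hγ hc h2 hb hk
  set e := ∑ i ∈ Finset.univ.erase k, c i ^ 2 with he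
  set δ := |lam k - s| with hδ
  have hδ0 : 0 ≤ δ := abs_nonneg _
  have he0 : 0 ≤ e := Finset.sum_nonneg fun i _ => sq_nonneg _
  have hdelta : δ * γ ≤ 3 / 2 * b ^ 2 := by
    have hsum : 3 * γ / 4 * |∑ i ∈ Finset.univ.erase k, c i ^ 2 * (lam i - s)| ≤ b ^ 2 := by
      refine (mul_le_mul_of_nonneg_left (Finset.abs_sum_le_sum_abs _ _) (by positivity)).trans ?_
      rw [← h2, ← Finset.add_sum_erase _ _ (Finset.mem_univ k), Finset.mul_sum]
      refine le_add_of_nonneg_of_le (by positivity) (Finset.sum_le_sum fun i hi => ?_)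
      have h3 := le_abs_sub_of_gap hγ hk (Finset.ne_of_mem_erase hi)
      rw [abs_mul, abs_of_nonneg (sq_nonneg (c i)), ← sq_abs (lam i - s)]
      have : 0 ≤ c i ^ 2 * |lam i - s| := by positivity
      nlinarith
    rw [← Finset.add_sum_erase _ _ (Finset.mem_univ k)] at h1
    have h4 : |∑ i ∈ Finset.univ.erase k, c i ^ 2 * (lam i - s)| = c k ^ 2 * δ := by
      rw [eq_neg_of_add_eq_zero_right h1, abs_neg, abs_mul, abs_of_nonneg (sq_nonneg (c k))]
    rw [h4] at hsum
    have : 8 / 9 * (γ * δ) ≤ c k ^ 2 * (γ * δ) :=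
      mul_le_mul_of_nonneg_right hck (by positivity)
    nlinarith
  have hrho : 8 / 9 * ρ ^ 2 ≤ δ ^ 2 := by
    have hdk : d k ^ 2 ≤ 1 := by
      rw [← hd]
      exact Finset.single_le_sum (f := fun i => d i ^ 2) (fun i _ => sq_nonneg _)
        (Finset.mem_univ k)
    have h5 : δ ^ 2 * d k ^ 2 = ρ ^ 2 * c k ^ 2 := by
      rw [hδ, sq_abs, ← mul_pow, hρ k, mul_pow]
    have h6 : δ ^ 2 * d k ^ 2 ≤ δ ^ 2 * 1 := mul_le_mul_of_nonneg_left hdk (sq_nonneg _)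
    have h7 : ρ ^ 2 * (8 / 9) ≤ ρ ^ 2 * c k ^ 2 := mul_le_mul_of_nonneg_left hck (sq_nonneg _)
    linarith
  have hsum : ∑ i, ((lam i - lam k) * d i) ^ 2 ≤ 4 * ρ ^ 2 * e := by
    rw [← Finset.add_sum_erase _ _ (Finset.mem_univ k), sub_self, zero_mul, he, Finset.mul_sum]
    rw [zero_pow two_ne_zero, zero_add]
    refine Finset.sum_le_sum fun i hi => ?_
    have h3 := le_abs_sub_of_gap hγ hk (Finset.ne_of_mem_erase hi)
    have h4 : |lam i - lam k| ≤ 2 * |lam i - s| := by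
      have : |lam i - lam k| ≤ |lam i - s| + |lam k - s| := by
        rw [show lam i - lam k = (lam i - s) - (lam k - s) by ring]
        exact abs_sub _ _
      linarith
    calc ((lam i - lam k) * d i) ^ 2 = |lam i - lam k| ^ 2 * d i ^ 2 := by rw [mul_pow, sq_abs]
      _ ≤ (2 * |lam i - s|) ^ 2 * d i ^ 2 := by gcongr
      _ = 4 * ((lam i - s) * d i) ^ 2 := by rw [mul_pow, sq_abs]; ring
      _ = 4 * ρ ^ 2 * c i ^ 2 := by rw [hρ i]; ring
  refine ⟨k, hsum.trans ?_⟩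
  have hγ4 : 0 < γ ^ 4 := by positivity
  have e1 : (16 / γ ^ 2 * |b| ^ 3) ^ 2 = 256 * b ^ 6 / γ ^ 4 := by
    rw [mul_pow, ← pow_mul, show |b| ^ (3 * 2) = (|b| ^ 2) ^ 3 by ring, sq_abs]
    field_simp
    ring
  rw [e1, le_div_iff₀ hγ4]
  have s1 : (ρ ^ 2 * γ ^ 2) ≤ 9 / 8 * (9 / 4 * b ^ 4) := by
    have : (δ * γ) ^ 2 ≤ (3 / 2 * b ^ 2) ^ 2 := by gcongr
    have : 8 / 9 * ρ ^ 2 * γ ^ 2 ≤ δ ^ 2 * γ ^ 2 := by gcongr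
    nlinarith
  have s2 : e * γ ^ 2 ≤ 16 / 9 * b ^ 2 := by linarith
  calc 4 * ρ ^ 2 * e * γ ^ 4 = 4 * ((ρ ^ 2 * γ ^ 2) * (e * γ ^ 2)) := by ring
    _ ≤ 4 * ((9 / 8 * (9 / 4 * b ^ 4)) * (16 / 9 * b ^ 2)) := by gcongr
    _ = 18 * b ^ 6 := by ring
    _ ≤ 256 * b ^ 6 := by
      have : 0 ≤ b ^ 6 := by positivity
      linarith

end Estimate

theorem sum_sq_col_mul {n : ℕ} {W : Matrix (Fin n) (Fin n) ℝ} (hW : W ∈ orthogonalGroup (Fin n) ℝ)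
    (X : Matrix (Fin n) (Fin n) ℝ) (j : Fin n) :
    ∑ i, (W * X) i j ^ 2 = ∑ i, X i j ^ 2 := by
  have h : (W * X)ᵀ * (W * X) = Xᵀ * X := by
    rw [transpose_mul, Matrix.mul_assoc, ← Matrix.mul_assoc Wᵀ, transpose_mul_self_of_orthogonal hW,
      Matrix.one_mul]
  have := congrFun (congrFun h j) j
  simpa only [mul_apply (M := (W * X)ᵀ), mul_apply (M := Xᵀ), transpose_apply, ← sq] using this

theorem sum_sq_col {n : ℕ} {W : Matrix (Fin n) (Fin n) ℝ} (hW : W ∈ orthogonalGroup (Fin n) ℝ)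
    (j : Fin n) : ∑ i, W i j ^ 2 = 1 := by
  have := sum_sq_col_mul hW 1 j
  rw [Matrix.mul_one] at this
  rw [this, Finset.sum_eq_single j]
  · simp
  · intro i _ h; simp [one_apply_ne h]
  · simp

theorem exists_gap {n : ℕ} {lam : Fin n → ℝ} (hlam : Function.Injective lam) :
    ∃ γ > 0, ∀ i j, i ≠ j → γ ≤ |lam i - lam j| := by
  have h : ∀ p : Fin n × Fin n, ∃ γ > 0, p.1 ≠ p.2 → γ ≤ |lam p.1 - lam p.2| := by
    rintro ⟨i, j⟩
    by_cases hij : i = j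
    · exact ⟨1, one_pos, fun h => absurd hij h⟩
    · exact ⟨_, abs_pos.2 (sub_ne_zero.2 fun h => hij (hlam h)), fun _ => le_rfl⟩
  choose g hg0 hg using h
  rcases isEmpty_or_nonempty (Fin n × Fin n) with he | hne
  · exact ⟨1, one_pos, fun i j _ => (he.false (i, j)).elim⟩
  · obtain ⟨p, hp⟩ := Finite.exists_min g
    exact ⟨g p, hg0 p, fun i j hij => (hp (i, j)).trans (hg (i, j) hij)⟩

/-- Spectral data of the last basis vector for a symmetric tridiagonal matrix. -/
theorem sum_sq_mul_sub_sq {m : ℕ} {lam : Fin (m + 2) → ℝ}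
    {T V : Matrix (Fin (m + 2)) (Fin (m + 2)) ℝ} (hT : T ∈ isospectral lam)
    (hV : V ∈ orthogonalGroup (Fin (m + 2)) ℝ) (hVT : V * T = diagonal lam * V) :
    ∑ i, V i (Fin.last _) ^ 2 * (lam i - T (Fin.last _) (Fin.last _)) ^ 2 = lastSub T ^ 2 := by
  set s := T (Fin.last _) (Fin.last _) with hs
  have h := sum_sq_col_mul hV (T - s • (1 : Matrix (Fin (m + 2)) (Fin (m + 2)) ℝ)) (Fin.last _)
  have e : ∀ i, (V * (T - s • (1 : Matrix (Fin (m + 2)) (Fin (m + 2)) ℝ))) i (Fin.last _) =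
      (lam i - s) * V i (Fin.last _) := fun i => by
    rw [Matrix.mul_sub, hVT, Matrix.mul_smul, Matrix.mul_one, Matrix.sub_apply, diagonal_mul,
      Matrix.smul_apply, smul_eq_mul, sub_mul]
  simp only [e] at h
  rw [Fin.sum_univ_castSucc (fun i => (T - s • (1 : Matrix (Fin (m + 2)) (Fin (m + 2)) ℝ)) i (Fin.last _) ^ 2),
    Finset.sum_eq_single (Fin.last m)] at h
  · simp only [Matrix.sub_apply, Matrix.smul_apply, one_apply_eq,
      one_apply_ne (Fin.castSucc_lt_last (Fin.last m)).ne, smul_eq_mul] at h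
    rw [← hs] at h
    rw [lastSub, ← hT.1.apply]
    simp only [mul_zero, sub_zero, mul_one, sub_self, ne_eq, OfNat.ofNat_ne_zero,
      not_false_eq_true, zero_pow, add_zero] at h
    rw [← h]
    exact Finset.sum_congr rfl fun i _ => by ring
  · intro a _ ha
    have : a.val ≠ m := fun h => ha (Fin.ext h)
    have := a.isLt
    rw [Matrix.sub_apply, hT.2.1 _ _ (Or.inl (by simp only [Fin.val_castSucc, Fin.val_last]; omega)),
      Matrix.smul_apply, one_apply_ne (Fin.castSucc_lt_last a).ne]
    simp
  · simp

theorem sum_sq_mul_sub {n : ℕ} {lam : Fin n → ℝ} {T V : Matrix (Fin n) (Fin n) ℝ}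
    (hV : V ∈ orthogonalGroup (Fin n) ℝ) (hVT : V * T = diagonal lam * V) (j : Fin n) :
    ∑ i, V i j ^ 2 * (lam i - T j j) = 0 := by
  have h : Vᵀ * (diagonal lam * V) = T := by
    rw [← hVT, ← Matrix.mul_assoc, transpose_mul_self_of_orthogonal hV, Matrix.one_mul]
  have h1 := congrFun (congrFun h j) j
  rw [mul_apply] at h1
  simp only [mul_sub, Finset.sum_sub_distrib, ← Finset.sum_mul, sum_sq_col hV, one_mul]
  rw [← h1, sub_eq_zero]
  exact Finset.sum_congr rfl fun i _ => by rw [transpose_apply, diagonal_mul]; ring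

theorem det_sub_smul_one_ne_zero {n : ℕ} {lam : Fin n → ℝ} {T V : Matrix (Fin n) (Fin n) ℝ}
    (hV : V ∈ orthogonalGroup (Fin n) ℝ) (hVT : V * T = diagonal lam * V) {s : ℝ}
    (hs : s ∉ Set.range lam) : (T - s • (1 : Matrix (Fin n) (Fin n) ℝ)).det ≠ 0 := by
  intro h0
  have e : V * (T - s • (1 : Matrix (Fin n) (Fin n) ℝ)) = diagonal (fun i => lam i - s) * V := by
    ext i j
    rw [Matrix.mul_sub, hVT, Matrix.mul_smul, Matrix.mul_one, Matrix.sub_apply, diagonal_mul,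
      Matrix.smul_apply, smul_eq_mul, diagonal_mul, sub_mul]
  have h := congrArg det e
  rw [det_mul, h0, mul_zero, det_mul, det_diagonal] at h
  rcases mul_eq_zero.1 h.symm with h | h
  · obtain ⟨i, -, hi⟩ := Finset.prod_eq_zero_iff.1 h
    exact hs ⟨i, sub_eq_zero.1 hi⟩
  · have := congrArg det (transpose_mul_self_of_orthogonal hV)
    simp [h] at this

theorem qrStep_mem_isospectral {n : ℕ} {lam : Fin n → ℝ} {T : Matrix (Fin n) (Fin n) ℝ}
    (hT : T ∈ isospectral lam) {s : ℝ} (hdet : (T - s • (1 : Matrix (Fin n) (Fin n) ℝ)).det ≠ 0) :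
    qrStep s T ∈ isospectral lam := by
  obtain ⟨R, hQ, hR, hR0, hQR⟩ := qrQ_spec hdet
  have hsymm : (qrStep s T).IsSymm := isSymm_transpose_mul_mul hT.1
  refine ⟨hsymm, isTridiagonal_of_mul_eq_mul hsymm hR hR0
    (fun i j hij => hT.2.1 i j (Or.inr hij)) ?_, isConj_diagonal_of_orthogonal hQ hT.2.2⟩
  rw [qrStep]
  set Q := qrQ (T - s • (1 : Matrix (Fin n) (Fin n) ℝ))
  have hR' : R = Qᵀ * (T - s • (1 : Matrix (Fin n) (Fin n) ℝ)) := by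
    rw [hQR, ← Matrix.mul_assoc, transpose_mul_self_of_orthogonal hQ, Matrix.one_mul]
  rw [Matrix.mul_assoc, ← hQR, hR', Matrix.mul_assoc, Matrix.mul_assoc, Matrix.mul_sub,
    Matrix.sub_mul]
  simp

theorem abs_lastSub_qrStep_le {m : ℕ} {lam : Fin (m + 2) → ℝ} {γ : ℝ} (hγ0 : 0 < γ)
    (hγ : ∀ i j, i ≠ j → γ ≤ |lam i - lam j|) {T V : Matrix (Fin (m + 2)) (Fin (m + 2)) ℝ}
    (hT : T ∈ isospectral lam) (hb : |lastSub T| ≤ γ / 4)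
    (hV : V ∈ orthogonalGroup (Fin (m + 2)) ℝ) (hVT : V * T = diagonal lam * V)
    (hs : T (Fin.last _) (Fin.last _) ∉ Set.range lam) :
    |lastSub (qrStep (T (Fin.last _) (Fin.last _)) T)| ≤ 16 / γ ^ 2 * |lastSub T| ^ 3 := by
  have hdet := det_sub_smul_one_ne_zero hV hVT hs
  have h1 := sum_sq_mul_sub hV hVT (Fin.last _)
  have h2 := sum_sq_mul_sub_sq hT hV hVT
  obtain ⟨hsymm, -, -⟩ := qrStep_mem_isospectral hT hdet
  set s := T (Fin.last _) (Fin.last _)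
  obtain ⟨R, hQ, hR, hR0, hQR⟩ := qrQ_spec hdet
  rw [qrStep] at hsymm ⊢
  set Q := qrQ (T - s • (1 : Matrix (Fin (m + 2)) (Fin (m + 2)) ℝ))
  have hQQ := mul_transpose_self_of_orthogonal hQ
  have hW : V * Q ∈ orthogonalGroup (Fin (m + 2)) ℝ := mul_mem hV hQ
  have hTQ : (T - s • (1 : Matrix (Fin (m + 2)) (Fin (m + 2)) ℝ)) * Q = Rᵀ := by
    have ht : (T - s • (1 : Matrix (Fin (m + 2)) (Fin (m + 2)) ℝ))ᵀ =
        T - s • (1 : Matrix (Fin (m + 2)) (Fin (m + 2)) ℝ) := by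
      rw [transpose_sub, hT.1.eq, transpose_smul, transpose_one]
    rw [← ht, hQR, transpose_mul, Matrix.mul_assoc, transpose_mul_self_of_orthogonal hQ,
      Matrix.mul_one]
  have hρ : ∀ i, (lam i - s) * (V * Q) i (Fin.last _) =
      R (Fin.last _) (Fin.last _) * V i (Fin.last _) := by
    intro i
    have e : V * Rᵀ = diagonal lam * (V * Q) - s • (V * Q) := by
      rw [← hTQ, Matrix.sub_mul, Matrix.mul_sub, ← Matrix.mul_assoc, hVT, Matrix.smul_mul,
        Matrix.one_mul, Matrix.mul_smul, Matrix.mul_assoc]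
    have e' := congrFun (congrFun e i) (Fin.last _)
    rw [Matrix.sub_apply, diagonal_mul, Matrix.smul_apply, smul_eq_mul, ← sub_mul] at e'
    rw [← e', mul_apply, Finset.sum_eq_single (Fin.last _), transpose_apply, mul_comm]
    · intro a _ ha
      rw [transpose_apply, hR _ _ (Fin.lt_last_iff_ne_last.2 ha), mul_zero]
    · simp
  obtain ⟨k, hk⟩ := exists_sum_residual_le hγ0 hγ (sum_sq_col hV _) (sum_sq_col hW _) h1 h2 hb hρ
  have hres : ∀ i, (V * Q * (Qᵀ * T * Q - lam k • (1 : Matrix (Fin (m + 2)) (Fin (m + 2)) ℝ))) i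
      (Fin.last _) = (lam i - lam k) * (V * Q) i (Fin.last _) := by
    intro i
    have e : V * Q * (Qᵀ * T * Q) = diagonal lam * (V * Q) := by
      rw [← Matrix.mul_assoc, ← Matrix.mul_assoc, Matrix.mul_assoc V, hQQ, Matrix.mul_one, hVT,
        Matrix.mul_assoc]
    rw [Matrix.mul_sub, e, Matrix.mul_smul, Matrix.mul_one, Matrix.sub_apply, diagonal_mul,
      Matrix.smul_apply, smul_eq_mul, sub_mul]
  simp only [← hres] at hk
  rw [sum_sq_col_mul hW] at hk
  have hle := (Finset.single_le_sum (f := fun i => (Qᵀ * T * Q -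
    lam k • (1 : Matrix (Fin (m + 2)) (Fin (m + 2)) ℝ)) i (Fin.last _) ^ 2)
    (fun i _ => sq_nonneg _) (Finset.mem_univ (Fin.last m).castSucc)).trans hk
  rw [Matrix.sub_apply, Matrix.smul_apply, one_apply_ne (Fin.castSucc_lt_last _).ne, smul_zero,
    sub_zero, hsymm.apply] at hle
  exact abs_le_of_sq_le_sq hle (by positivity)

/-- Domain, invariance and cubic decay of the Rayleigh step at a single matrix. -/
theorem rayleighStep_spec {m : ℕ} {lam : Fin (m + 2) → ℝ} (hlam : Function.Injective lam) {γ : ℝ}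
    (hγ0 : 0 < γ) (hγ : ∀ i j, i ≠ j → γ ≤ |lam i - lam j|)
    {T : Matrix (Fin (m + 2)) (Fin (m + 2)) ℝ} (hT : T ∈ isospectral lam)
    (hb : |lastSub T| ≤ γ / 4) :
    T ∈ rayleighDomain lam ∧ rayleighStep lam T ∈ isospectral lam ∧
      |lastSub (rayleighStep lam T)| ≤ 16 / γ ^ 2 * |lastSub T| ^ 3 := by
  obtain ⟨V, hV, hVT⟩ := exists_orthogonal_diagonalization hlam hT.1 hT.2.2
  rw [rayleighStep, shiftStep]
  by_cases hs : T (Fin.last _) (Fin.last _) ∈ Set.range lam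
  · rw [if_neg (not_not.2 hs)]
    obtain ⟨k, hk⟩ := hs
    have hVk : V k (Fin.last _) ≠ 0 := by
      intro h0
      have := le_sq_of_gap hγ0 hγ (sum_sq_col hV _) (sum_sq_mul_sub_sq hT hV hVT) hb (k := k)
        (by rw [hk, sub_self, abs_zero]; positivity)
      rw [h0] at this
      norm_num at this
    obtain ⟨π, hπ, hTπ⟩ := exists_mem_chartDomain hT hV hVT hVk
    have hex : ∃ π : Equiv.Perm (Fin (m + 2)),
        lam (π (Fin.last _)) = T (Fin.last _) (Fin.last _) ∧ T ∈ chartDomain lam π :=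
      ⟨π, by rw [hπ, hk], hTπ⟩
    have hε := (Classical.epsilon_spec hex).1
    refine ⟨⟨hT, hT, Or.inr hex⟩, chartInv_mem_isospectral hlam _ _, ?_⟩
    rw [chartStep, lastSub_chartInv_eq_zero hlam, abs_zero]
    · positivity
    · rw [Fin.succ_last, hε, sub_self, zero_div, abs_zero, zero_mul]
  · rw [if_pos hs]
    exact ⟨⟨hT, hT, Or.inl hs⟩, qrStep_mem_isospectral hT (det_sub_smul_one_ne_zero hV hVT hs),
      abs_lastSub_qrStep_le hγ0 hγ hT hb hV hVT hs⟩

end RayleighQR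

theorem theorem4p2 {m : ℕ} (lam : Fin (m + 2) → ℝ) (hlam : Function.Injective lam) :
    ∃ ε > (0 : ℝ), ∃ c > (0 : ℝ),
      RayleighQR.deflation lam ε ⊆ RayleighQR.rayleighDomain lam ∧
      Set.MapsTo (RayleighQR.rayleighStep lam)
        (RayleighQR.deflation lam ε) (RayleighQR.deflation lam ε) ∧
      ∀ T ∈ RayleighQR.deflation lam ε,
        |RayleighQR.lastSub (RayleighQR.rayleighStep lam T)| ≤
          c * |RayleighQR.lastSub T| ^ 3 := by
  obtain ⟨γ, hγ0, hγ⟩ := RayleighQR.exists_gap hlam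
  have h := fun T (hT : T ∈ RayleighQR.deflation lam (γ / 4)) =>
    RayleighQR.rayleighStep_spec hlam hγ0 hγ hT.1 hT.2
  refine ⟨γ / 4, by positivity, 16 / γ ^ 2, by positivity, fun T hT => (h T hT).1,
    fun T hT => ⟨(h T hT).2.1, (h T hT).2.2.trans ?_⟩, fun T hT => (h T hT).2.2⟩
  calc 16 / γ ^ 2 * |RayleighQR.lastSub T| ^ 3 ≤ 16 / γ ^ 2 * (γ / 4) ^ 3 := by
        gcongr
        exact hT.2
    _ = γ / 4 := by
        field_simp
        norm_num
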